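/- Let $n \ge 2$ and let $X_1,\dots,X_n$ be independent real random variables on a probability space, all with the same distribution $\nu$. Define the sample mean and the sample variance by $$\bar X_n=\frac1n\sum_{i=1}^n X_i,\qquad s_n^2=\frac1{n-1}\sum_{i=1}^n (X_i-\bar X_n)^2 .$$ Then $\bar X_n$ and $s_n^2$ are independent if and only if $\nu$ is a normal distribution, i.e. $\nu=N(\mu,\sigma^2)$ for some $\mu\in\mathbb R$ and $\sigma^2\ge 0$, where $N(\mu,0)$ denotes the point mass at $\mu$. No density or moment of $\nu$ is assumed to exist. -/

import Mathlib

open MeasureTheory ProbabilityTheory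
open scoped NNReal

/-- The sample mean `(X₁ + ⋯ + Xₙ) / n`, as a random variable. -/
noncomputable def sampleMean {Ω : Type*} {n : ℕ} (X : Fin n → Ω → ℝ) (ω : Ω) : ℝ :=
  (∑ i, X i ω) / (n : ℝ)

/-- The (Bessel corrected) sample variance `(1 / (n - 1)) * ∑ᵢ (Xᵢ - X̄ₙ)²`, as a random
variable. It is meaningful for `2 ≤ n`. -/
noncomputable def sampleVariance {Ω : Type*} {n : ℕ} (X : Fin n → Ω → ℝ) (ω : Ω) : ℝ :=
  (∑ i, (X i ω - sampleMean X ω) ^ 2) / ((n : ℝ) - 1)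

/-- A measure on `ℝ` is a normal distribution `N(m, v)` for some mean `m` and variance `v ≥ 0`;
the case `v = 0` is the point mass at `m`. -/
def IsNormalDistribution (ν : Measure ℝ) : Prop :=
  ∃ (m : ℝ) (v : ℝ≥0), ν = gaussianReal m v

/-! Since `∑ xᵢ² = (n - 1) V + n M²`, the weight `exp (∑ (t xᵢ - xᵢ²))` is a function of the mean
`M` times a function of the variance `V`, and `t` enters only the first factor. If `M` and `V` are
independent, reweighting by it leaves the law of `V` free of `t`. By `pi_tilted` the reweighted
sample is again i.i.d., with law `ν` tilted by `t x - x²`, so unbiasedness makes the variance of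
that law constant in `t` (`exists_variance_tilted_eq`). This variance is the second derivative of
the cgf of `ν` tilted by `-x²`, so that cgf is quadratic and the tilted law normal; undoing the tilt
gives `ν`. The factor `exp (-x²)` replaces any moment assumption. Conversely, in a Gaussian sample
the mean is uncorrelated, hence independent, from the residuals. -/

/-- A product of exponentially tilted measures is the tilting of the product measure by the sum of
the exponents. -/
theorem pi_tilted {ι : Type*} [Fintype ι] {α : ι → Type*} [∀ i, MeasurableSpace (α i)]
    (μ : ∀ i, Measure (α i)) [∀ i, IsProbabilityMeasure (μ i)] (f : ∀ i, α i → ℝ) :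
    Measure.pi (fun i ↦ (μ i).tilted (f i)) =
      (Measure.pi μ).tilted (fun x ↦ ∑ i, f i (x i)) := by
  refine Measure.pi_eq (μ := fun i ↦ (μ i).tilted (f i)) fun s hs ↦ ?_
  have hZ : ∫ x, Real.exp (∑ i, f i (x i)) ∂(Measure.pi μ) =
      ∏ i, ∫ x, Real.exp (f i x) ∂(μ i) := by
    simp_rw [Real.exp_sum]
    exact integral_fintype_prod_eq_prod (fun i x ↦ Real.exp (f i x))
  rw [tilted_apply_eq_ofReal_integral, Measure.restrict_pi_pi, hZ]
  simp_rw [Real.exp_sum, ← Finset.prod_div_distrib]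
  rw [integral_fintype_prod_eq_prod (fun i x ↦ Real.exp (f i x) / ∫ y, Real.exp (f i y) ∂(μ i)),
    ENNReal.ofReal_prod_of_nonneg fun i _ ↦ integral_nonneg fun x ↦ by positivity]
  simp_rw [tilted_apply_eq_ofReal_integral]

theorem sum_sq_sub_sampleMean {Ω : Type*} {n : ℕ} (hn : 2 ≤ n) (X : Fin n → Ω → ℝ) (ω : Ω) :
    ∑ i, X i ω ^ 2 = ((n : ℝ) - 1) * sampleVariance X ω + n * sampleMean X ω ^ 2 := by
  have hn' : (2 : ℝ) ≤ n := by exact_mod_cast hn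
  have h1 : (n : ℝ) - 1 ≠ 0 := by linarith
  have hS : ∑ i, X i ω = n * sampleMean X ω := by
    rw [sampleMean]; field_simp
  rw [sampleVariance, mul_div_cancel₀ _ h1]
  simp_rw [sub_sq]
  rw [Finset.sum_add_distrib, Finset.sum_sub_distrib, ← Finset.sum_mul, ← Finset.mul_sum, hS]
  simp
  ring

/-- The sample variance of a square-integrable i.i.d. sample is unbiased. -/
theorem integral_sampleVariance {Ω : Type*} [MeasurableSpace Ω] {P : Measure Ω}
    [IsProbabilityMeasure P] {n : ℕ} (hn : 2 ≤ n) {ν : Measure ℝ} {X : Fin n → Ω → ℝ}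
    (h_law : ∀ i, HasLaw (X i) ν P) (h_indep : iIndepFun X P) (hν : MemLp id 2 ν) :
    ∫ ω, sampleVariance X ω ∂P = Var[id; ν] := by
  have hn' : (2 : ℝ) ≤ n := by exact_mod_cast hn
  have hn1 : (n : ℝ) - 1 ≠ 0 := by linarith
  have hn0 : (n : ℝ) ≠ 0 := by linarith
  have : IsProbabilityMeasure ν :=
    (h_law ⟨0, by lia⟩).isProbabilityMeasure_iff.1 inferInstance
  have hX : ∀ i, MemLp (X i) 2 P := fun i ↦ by
    have := (h_law i).map_eq ▸ hν
    exact (memLp_map_measure_iff this.1 (h_law i).aemeasurable).1 this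
  have hvar : ∀ i, Var[X i; P] = Var[id; ν] := fun i ↦ (h_law i).variance_eq
  have hmean : ∀ i, ∫ ω, X i ω ∂P = ∫ x, x ∂ν := fun i ↦ (h_law i).integral_eq
  have hsq : ∀ i, ∫ ω, X i ω ^ 2 ∂P = Var[id; ν] + (∫ x, x ∂ν) ^ 2 := fun i ↦ by
    have := variance_eq_sub (hX i)
    simp only [hvar, hmean, Pi.pow_apply] at this
    linarith
  have hM : MemLp (sampleMean X) 2 P := by
    have := (memLp_finsetSum (μ := P) (p := 2) Finset.univ fun i _ ↦ hX i).mul_const (n : ℝ)⁻¹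
    simpa only [sampleMean, div_eq_mul_inv] using! this
  have hMvar : Var[sampleMean X; P] = Var[id; ν] / n := by
    have h := IndepFun.variance_sum (s := Finset.univ) (fun i _ ↦ hX i)
      (fun i _ j _ hij ↦ h_indep.indepFun hij)
    have hM' : sampleMean X = fun ω ↦ (n : ℝ)⁻¹ * (∑ i, X i) ω := by
      ext ω; simp [sampleMean, div_eq_inv_mul]
    rw [hM', variance_const_mul, h]
    simp only [hvar, Finset.sum_const, Finset.card_univ, Fintype.card_fin, nsmul_eq_mul]
    field_simp
  have hMmean : ∫ ω, sampleMean X ω ∂P = ∫ x, x ∂ν := by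
    simp only [sampleMean]
    rw [integral_div, integral_finsetSum _ fun i _ ↦ (hX i).integrable (by norm_num)]
    simp only [hmean, Finset.sum_const, Finset.card_univ, Fintype.card_fin, nsmul_eq_mul]
    field_simp
  have hMsq : ∫ ω, sampleMean X ω ^ 2 ∂P = Var[id; ν] / n + (∫ x, x ∂ν) ^ 2 := by
    have := variance_eq_sub hM
    simp only [hMvar, hMmean, Pi.pow_apply] at this
    linarith
  have hV : sampleVariance X =
      fun ω ↦ (∑ i, X i ω ^ 2 - n * sampleMean X ω ^ 2) / ((n : ℝ) - 1) := by
    ext ω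
    rw [sum_sq_sub_sampleMean hn X ω]
    field_simp
    ring
  rw [hV, integral_div, integral_sub (integrable_finsetSum _ fun i _ ↦ (hX i).integrable_sq)
    (hM.integrable_sq.const_mul _), integral_finsetSum _ fun i _ ↦ (hX i).integrable_sq,
    integral_const_mul, hMsq]
  simp only [hsq, Finset.sum_const, Finset.card_univ, Fintype.card_fin, nsmul_eq_mul]
  field_simp
  ring

/-- A probability measure whose cumulant generating function is finite everywhere and has constant
second derivative is a normal distribution. -/
theorem isNormalDistribution_of_iteratedDeriv_two_cgf_eq {μ : Measure ℝ} [IsProbabilityMeasure μ]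
    (h_int : integrableExpSet id μ = Set.univ) {c : ℝ} (hc : 0 ≤ c)
    (h : ∀ t, iteratedDeriv 2 (cgf id μ) t = c) : IsNormalDistribution μ := by
  have hint : ∀ t, t ∈ interior (integrableExpSet id μ) := by simp [h_int]
  have hd : ∀ t, HasDerivAt (cgf id μ) (deriv (cgf id μ) t) t := fun t ↦
    (analyticAt_cgf (hint t)).differentiableAt.hasDerivAt
  have hd2 : ∀ t, HasDerivAt (deriv (cgf id μ)) c t := fun t ↦ by
    have := (analyticAt_cgf (hint t)).deriv.differentiableAt.hasDerivAt
    rwa [← h t, iteratedDeriv_succ, iteratedDeriv_one]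
  set m := deriv (cgf id μ) 0 with hm
  have h1 : ∀ t, deriv (cgf id μ) t = m + c * t := fun t ↦ by
    have hz : ∀ s, HasDerivAt (fun s ↦ deriv (cgf id μ) s - c * s) 0 s := fun s ↦ by
      simpa using! (hd2 s).sub ((hasDerivAt_id s).const_mul c)
    have := is_const_of_deriv_eq_zero (fun s ↦ (hz s).differentiableAt) (fun s ↦ (hz s).deriv) t 0
    simp only [mul_zero, sub_zero, ← hm] at this
    linarith
  have h2 : ∀ t, cgf id μ t = m * t + c * t ^ 2 / 2 := fun t ↦ by
    have hz : ∀ s, HasDerivAt (fun s ↦ cgf id μ s - (m * s + c * s ^ 2 / 2)) 0 s := fun s ↦ by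
      have := (hd s).sub (((hasDerivAt_id s).const_mul m).add
        (((hasDerivAt_pow 2 s).const_mul c).div_const 2))
      refine this.congr_deriv ?_
      rw [h1 s]
      simp
      ring
    have := is_const_of_deriv_eq_zero (fun s ↦ (hz s).differentiableAt) (fun s ↦ (hz s).deriv) t 0
    simp at this
    linarith
  lift c to ℝ≥0 using hc
  refine ⟨m, c, Measure.ext_of_complexMGF_id_eq ?_⟩
  have hmgf : mgf id μ = mgf id (gaussianReal m c) := by
    ext t
    have ht : Integrable (fun ω ↦ Real.exp (t * id ω)) μ :=
      interior_subset (s := integrableExpSet id μ) (hint t)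
    rw [mgf_id_gaussianReal, ← exp_cgf ht, h2]
  -- Equality of the mgfs on the real line extends analytically to the whole plane.
  ext z
  exact eqOn_complexMGF_of_mgf hmgf (hint z.re)

theorem gaussianReal_eq_tilted (m : ℝ) {v : ℝ≥0} (hv : v ≠ 0) :
    gaussianReal m v = volume.tilted (fun x ↦ -(x - m) ^ 2 / (2 * v)) := by
  have h1 := integral_gaussianPDFReal_eq_one m hv
  simp only [gaussianPDFReal, integral_const_mul] at h1
  have hZ := eq_inv_of_mul_eq_one_right h1
  rw [gaussianReal_of_var_ne_zero m hv, Measure.tilted, hZ]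
  congr 1
  ext x
  simp only [gaussianPDF, gaussianPDFReal, inv_inv]
  rw [mul_comm, ← div_eq_mul_inv]

/-- Adding the reflection `x ↦ -x` removes the linear term, as `exp (b x) + exp (-b x) ≥ 1`. -/
theorem integrable_exp_neg_sq_of_integrable_exp_neg_sq_add {a b c : ℝ}
    (h : Integrable (fun x : ℝ ↦ Real.exp (-a * x ^ 2 + b * x + c))) :
    Integrable (fun x : ℝ ↦ Real.exp (-a * x ^ 2)) := by
  refine ((h.add h.comp_neg).mul_const (Real.exp (-c))).mono' (by fun_prop) (ae_of_all _ fun x ↦ ?_)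
  rw [Real.norm_of_nonneg (by positivity)]
  simp only [Pi.add_apply, Real.exp_add, neg_sq, mul_neg]
  have hb : 1 ≤ Real.exp (b * x) + Real.exp (-(b * x)) := by
    rcases le_total 0 (b * x) with h | h
    · linarith [Real.one_le_exp h, Real.exp_pos (-(b * x))]
    · linarith [Real.one_le_exp (neg_nonneg.2 h), Real.exp_pos (b * x)]
  have hc : Real.exp c * Real.exp (-c) = 1 := by rw [← Real.exp_add]; simp
  calc Real.exp (-a * x ^ 2) ≤ Real.exp (-a * x ^ 2) * (Real.exp (b * x) + Real.exp (-(b * x))) :=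
        le_mul_of_one_le_right (by positivity) hb
    _ = _ := by linear_combination (-Real.exp (-a * x ^ 2) *
          (Real.exp (b * x) + Real.exp (-(b * x)))) * hc

theorem integrable_exp_mul_sub_sq (μ : Measure ℝ) [IsFiniteMeasure μ] (t : ℝ) :
    Integrable (fun x ↦ Real.exp (t * x - x ^ 2)) μ := by
  refine Integrable.of_bound (by fun_prop) (Real.exp (t ^ 2 / 4)) (ae_of_all _ fun x ↦ ?_)
  rw [Real.norm_of_nonneg (by positivity), Real.exp_le_exp]
  nlinarith [sq_nonneg (x - t / 2)]

/-- A probability measure is normal as soon as its tilting by `-x²` is normal. -/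
theorem isNormalDistribution_of_tilted_neg_sq {ν : Measure ℝ} [IsProbabilityMeasure ν]
    (h : IsNormalDistribution (ν.tilted (fun x ↦ -x ^ 2))) : IsNormalDistribution ν := by
  obtain ⟨m, v, h⟩ := h
  have hν : (gaussianReal m v).tilted (fun x ↦ x ^ 2) = ν := by
    have := tilted_neg_same (μ := ν) (f := fun x ↦ -x ^ 2)
      (by simpa using integrable_exp_mul_sub_sq ν 0)
    rw [h] at this
    simpa only [Pi.neg_def, neg_neg] using this
  by_cases hv : v = 0
  · subst hv
    refine ⟨m, 0, ?_⟩
    -- Tilting creates no mass outside the atom.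
    have hac : ν ≪ Measure.dirac m := by
      rw [← hν, gaussianReal_zero_var]
      exact tilted_absolutelyContinuous _ _
    rw [gaussianReal_zero_var]
    have hae : id =ᵐ[ν] fun _ ↦ m := hac.ae_le (ae_eq_dirac id)
    simpa using (hasLaw_dirac_of_ae_eq hae).map_eq
  have hv' : (0 : ℝ) < v := by positivity
  set f : ℝ → ℝ := fun x ↦ -(x - m) ^ 2 / (2 * v)
  set g : ℝ → ℝ := fun x ↦ x ^ 2
  have hf : Integrable (fun x ↦ Real.exp (f x)) := by
    by_contra hf
    have := gaussianReal_eq_tilted m hv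
    rw [tilted_of_not_integrable hf] at this
    exact IsProbabilityMeasure.ne_zero _ this
  rw [gaussianReal_eq_tilted m hv, tilted_tilted hf] at hν
  -- Tilting by a non-integrable weight gives the zero measure, but `ν` has mass one. Integrability
  -- then forces `v < 1/2`.
  have hfg : Integrable (fun x ↦ Real.exp ((f + g) x)) := by
    by_contra hfg
    rw [tilted_of_not_integrable hfg] at hν
    exact IsProbabilityMeasure.ne_zero _ hν.symm
  have ha : 0 < 1 / (2 * (v : ℝ)) - 1 := by
    rw [← integrable_exp_neg_mul_sq_iff]
    refine integrable_exp_neg_sq_of_integrable_exp_neg_sq_add (b := m / v)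
      (c := -m ^ 2 / (2 * v)) (hfg.congr (ae_of_all _ fun x ↦ ?_))
    simp only [f, g, Pi.add_apply]
    congr 1
    field_simp
    ring
  have hv1 : 0 < 1 - 2 * (v : ℝ) := by
    have : 1 - 2 * (v : ℝ) = (1 / (2 * (v : ℝ)) - 1) * (2 * v) := by field_simp
    rw [this]; positivity
  -- Completing the square: `1 / (2w) = 1 / (2v) - 1`.
  obtain ⟨w, hw⟩ : ∃ w : ℝ≥0, (w : ℝ) = v / (1 - 2 * v) :=
    ⟨⟨v / (1 - 2 * v), by positivity⟩, rfl⟩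
  have hw0 : w ≠ 0 := by
    rw [← NNReal.coe_ne_zero, hw]; positivity
  refine ⟨m / (1 - 2 * v), w, ?_⟩
  have hcst : f + g = (fun _ ↦ m ^ 2 / (1 - 2 * (v : ℝ))) +
      fun x ↦ -(x - m / (1 - 2 * v)) ^ 2 / (2 * (w : ℝ)) := by
    ext x
    simp only [f, g, Pi.add_apply, hw]
    field_simp
    ring
  have hfg' : Integrable
      (fun x : ℝ ↦ Real.exp (-(x - m / (1 - 2 * v)) ^ 2 / (2 * (w : ℝ)))) := by
    refine (hfg.mul_const (Real.exp (-(m ^ 2 / (1 - 2 * (v : ℝ)))))).congr (ae_of_all _ fun x ↦ ?_)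
    rw [hcst]
    simp only [Pi.add_apply, ← Real.exp_add]
    congr 1
    ring
  rw [← hν, hcst, add_comm, ← tilted_tilted hfg', ← gaussianReal_eq_tilted _ hw0, tilted_const]

theorem measurable_sampleMean_eval {n : ℕ} :
    Measurable (sampleMean fun (i : Fin n) (x : Fin n → ℝ) ↦ x i) := by
  unfold sampleMean
  fun_prop

theorem measurable_sampleVariance_eval {n : ℕ} :
    Measurable (sampleVariance fun (i : Fin n) (x : Fin n → ℝ) ↦ x i) := by
  have := measurable_sampleMean_eval (n := n)
  unfold sampleVariance
  fun_prop

theorem indepFun_sampleMean_sampleVariance_eval {Ω : Type*} [MeasurableSpace Ω] {P : Measure Ω}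
    [IsProbabilityMeasure P] {n : ℕ} {ν : Measure ℝ} [IsProbabilityMeasure ν]
    {X : Fin n → Ω → ℝ} (h_law : ∀ i, HasLaw (X i) ν P) (h_indep : iIndepFun X P)
    (h : IndepFun (sampleMean X) (sampleVariance X) P) :
    IndepFun (sampleMean fun (i : Fin n) (x : Fin n → ℝ) ↦ x i)
      (sampleVariance fun (i : Fin n) (x : Fin n → ℝ) ↦ x i) (Measure.pi fun _ : Fin n ↦ ν) := by
  have hl := h_indep.hasLaw_pi h_law
  have hid : IdentDistrib (fun ω i ↦ X i ω) id P (Measure.pi fun _ : Fin n ↦ ν) :=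
    ⟨hl.aemeasurable, aemeasurable_id, by rw [hl.map_eq, Measure.map_id]⟩
  exact indepFun_of_identDistrib_pair h
    (hid.comp (measurable_sampleMean_eval.prodMk measurable_sampleVariance_eval))

/-- If the mean and the variance of a sample from `ν` are independent, then the variance of the
measure with density proportional to `exp (t * x - x ^ 2)` with respect to `ν` does not depend
on `t`. -/
theorem exists_variance_tilted_eq {n : ℕ} (hn : 2 ≤ n) {ν : Measure ℝ} [IsProbabilityMeasure ν]
    (h : IndepFun (sampleMean fun (i : Fin n) (x : Fin n → ℝ) ↦ x i)
      (sampleVariance fun (i : Fin n) (x : Fin n → ℝ) ↦ x i) (Measure.pi fun _ : Fin n ↦ ν)) :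
    ∃ c, ∀ t, MemLp id 2 (ν.tilted (fun x ↦ t * x - x ^ 2)) →
      Var[id; ν.tilted (fun x ↦ t * x - x ^ 2)] = c := by
  set M := sampleMean fun (i : Fin n) (x : Fin n → ℝ) ↦ x i
  set V := sampleVariance fun (i : Fin n) (x : Fin n → ℝ) ↦ x i
  set Q := Measure.pi fun _ : Fin n ↦ ν
  have hM : Measurable M := measurable_sampleMean_eval
  have hV : Measurable V := measurable_sampleVariance_eval
  -- The mean of `V` under `Q` tilted by `-(n - 1) V`.
  refine ⟨(∫ x, V x * Real.exp (-((n - 1) * V x)) ∂Q) / ∫ x, Real.exp (-((n - 1) * V x)) ∂Q,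
    fun t ht ↦ ?_⟩
  have hint := integrable_exp_mul_sub_sq ν t
  have : IsProbabilityMeasure (ν.tilted (fun x ↦ t * x - x ^ 2)) := isProbabilityMeasure_tilted hint
  set φ : ℝ → ℝ := fun m ↦ Real.exp (n * (t * m) - n * m ^ 2)
  have hexp : ∀ x : Fin n → ℝ, Real.exp (∑ i, (t * x i - x i ^ 2)) =
      φ (M x) * Real.exp (-((n - 1) * V x)) := fun x ↦ by
    have hs := sum_sq_sub_sampleMean hn (fun (i : Fin n) (x : Fin n → ℝ) ↦ x i) x
    have hn0 : (n : ℝ) ≠ 0 := by positivity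
    have hm : ∑ i, x i = n * M x := by
      simp only [M, sampleMean]; field_simp
    rw [← Real.exp_add, Finset.sum_sub_distrib, ← Finset.mul_sum, hs, hm]
    congr 1
    ring
  have hZ : ∫ x, Real.exp (∑ i, (t * x i - x i ^ 2)) ∂Q =
      (∫ x, φ (M x) ∂Q) * ∫ x, Real.exp (-((n - 1) * V x)) ∂Q := by
    simp_rw [hexp]
    exact h.integral_fun_comp_mul_comp (f := φ) (g := fun v ↦ Real.exp (-((n - 1) * v)))
      hM.aemeasurable hV.aemeasurable (by fun_prop) (by fun_prop)
  have hN : ∫ x, φ (M x) * (V x * Real.exp (-((n - 1) * V x))) ∂Q =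
      (∫ x, φ (M x) ∂Q) * ∫ x, V x * Real.exp (-((n - 1) * V x)) ∂Q :=
    h.integral_fun_comp_mul_comp (f := φ) (g := fun v ↦ v * Real.exp (-((n - 1) * v)))
      hM.aemeasurable hV.aemeasurable (by fun_prop) (by fun_prop)
  have hZ0 : ∫ x, Real.exp (∑ i, (t * x i - x i ^ 2)) ∂Q ≠ 0 := by
    simp_rw [Real.exp_sum]
    rw [integral_fintype_prod_eq_pow (fun x ↦ Real.exp (t * x - x ^ 2))]
    exact pow_ne_zero _ (integral_exp_pos hint).ne'
  have hvar := integral_sampleVariance (X := fun (i : Fin n) (x : Fin n → ℝ) ↦ x i)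
    (P := Measure.pi fun _ : Fin n ↦ ν.tilted (fun x ↦ t * x - x ^ 2)) hn
    (fun i ↦ (measurePreserving_eval (fun _ : Fin n ↦ ν.tilted (fun x ↦ t * x - x ^ 2)) i).hasLaw)
    (iIndepFun_pi (X := fun _ ↦ id) fun _ ↦ aemeasurable_id) ht
  rw [← hvar, pi_tilted (fun _ ↦ ν) (fun _ x ↦ t * x - x ^ 2), integral_tilted]
  have hA : ∫ x, φ (M x) ∂Q ≠ 0 := fun h0 ↦ hZ0 (by rw [hZ, h0, zero_mul])
  -- The factor `∫ φ (M x)`, which carries all dependence on `t`, cancels.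
  rw [← mul_div_mul_left _ _ hA, ← hZ, ← hN, ← integral_div]
  refine integral_congr_ae (ae_of_all _ fun x ↦ ?_)
  simp only [hexp, smul_eq_mul]
  ring

theorem isNormalDistribution_of_indepFun_eval {n : ℕ} (hn : 2 ≤ n) {ν : Measure ℝ}
    [IsProbabilityMeasure ν]
    (h : IndepFun (sampleMean fun (i : Fin n) (x : Fin n → ℝ) ↦ x i)
      (sampleVariance fun (i : Fin n) (x : Fin n → ℝ) ↦ x i) (Measure.pi fun _ : Fin n ↦ ν)) :
    IsNormalDistribution ν := by
  obtain ⟨c, hc⟩ := exists_variance_tilted_eq hn h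
  have hint : Integrable (fun x ↦ Real.exp (-x ^ 2)) ν := by
    simpa using integrable_exp_mul_sub_sq ν 0
  have := isProbabilityMeasure_tilted hint
  have htt : ∀ t : ℝ, (ν.tilted (fun x ↦ -x ^ 2)).tilted (fun x ↦ t * id x) =
      ν.tilted (fun x ↦ t * x - x ^ 2) := fun t ↦ by
    rw [tilted_tilted hint]
    congr 1
    ext x
    simp only [Pi.add_apply, id]
    ring
  have hset : integrableExpSet id (ν.tilted (fun x ↦ -x ^ 2)) = Set.univ := by
    refine Set.eq_univ_of_forall fun t ↦ ?_
    refine (integrable_tilted_iff (f := fun x ↦ -x ^ 2) hint _).2 ?_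
    refine (integrable_exp_mul_sub_sq ν t).congr (ae_of_all _ fun x ↦ ?_)
    simp only [smul_eq_mul, id, ← Real.exp_add]
    congr 1
    ring
  have hmem : ∀ t, t ∈ interior (integrableExpSet id (ν.tilted (fun x ↦ -x ^ 2))) := by
    simp [hset]
  have hvar : ∀ t, Var[id; ν.tilted (fun x ↦ t * x - x ^ 2)] = c := fun t ↦
    hc t (htt t ▸ memLp_tilted_mul (hmem t) 2)
  refine isNormalDistribution_of_tilted_neg_sq
    (isNormalDistribution_of_iteratedDeriv_two_cgf_eq hset (hvar 0 ▸ variance_nonneg _ _)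
      fun t ↦ ?_)
  rw [← variance_tilted_mul (hmem t), htt, hvar]

/-- The mean and the variance of a sample from a normal distribution are independent. -/
theorem indepFun_sampleMean_sampleVariance_of_gaussian {Ω : Type*} [MeasurableSpace Ω]
    {P : Measure Ω} [IsProbabilityMeasure P] {n : ℕ} (hn : 2 ≤ n) {m : ℝ} {v : ℝ≥0}
    {X : Fin n → Ω → ℝ} (h_law : ∀ i, HasLaw (X i) (gaussianReal m v) P)
    (h_indep : iIndepFun X P) : IndepFun (sampleMean X) (sampleVariance X) P := by
  have hn0 : (n : ℝ) ≠ 0 := by positivity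
  have hX := fun i ↦ (h_law i).hasGaussianLaw
  have hj := h_indep.hasGaussianLaw hX
  let p := ContinuousLinearMap.proj (R := ℝ) (φ := fun _ : Fin n ↦ ℝ)
  let A : (Fin n → ℝ) →L[ℝ] ℝ := (n : ℝ)⁻¹ • ∑ i, p i
  have hA : ∀ ω, A (fun i ↦ X i ω) = sampleMean X ω := fun ω ↦ by
    simp [A, p, sampleMean, div_eq_inv_mul]
  let B : (Fin n → ℝ) →L[ℝ] (Fin n → ℝ) := ContinuousLinearMap.pi fun i ↦ p i - A
  have hB : ∀ ω i, B (fun i ↦ X i ω) i = X i ω - sampleMean X ω := fun ω i ↦ by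
    simp [B, p, hA]
  have hpair := hj.map_fun ((ContinuousLinearMap.pi fun _ : Unit ↦ A).prod B)
  have hmem := fun i ↦ (hX i).memLp_two
  have hM : MemLp (sampleMean X) 2 P := by
    have := (hj.map_fun A).memLp_two
    simpa only [hA] using this
  -- The mean is viewed as a family over `Unit`, to fit the covariance criterion for jointly
  -- Gaussian families.
  have hind : IndepFun (fun ω (_ : Unit) ↦ sampleMean X ω)
      (fun ω i ↦ X i ω - sampleMean X ω) P := by
    refine HasGaussianLaw.indepFun_of_covariance_eval ?_ fun _ i ↦ ?_
    · refine hpair.congr (ae_of_all _ fun ω ↦ ?_)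
      ext <;> simp [hA, hB]
    have hcov : ∀ i j, cov[X j, X i; P] = if j = i then (v : ℝ) else 0 := fun i j ↦ by
      split_ifs with hij
      · rw [hij, covariance_self (hX i).aemeasurable, (h_law i).variance_eq, variance_id_gaussianReal]
      · exact (h_indep.indepFun hij).covariance_eq_zero (hmem j) (hmem i)
    have hc1 : ∀ i, cov[sampleMean X, X i; P] = v / n := fun i ↦ by
      unfold sampleMean
      rw [covariance_fun_div_left, covariance_fun_sum_left hmem (hmem i)]
      simp [hcov]
    have hc2 : cov[sampleMean X, sampleMean X; P] = v / n := by
      conv_lhs => enter [2]; unfold sampleMean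
      rw [covariance_fun_div_right, covariance_fun_sum_right hmem hM]
      simp [hc1]
      field_simp
    rw [covariance_fun_sub_right hM (hmem i) hM, hc1, hc2, sub_self]
  exact hind.comp (φ := fun f : Unit → ℝ ↦ f ()) (ψ := fun y : Fin n → ℝ ↦ (∑ i, y i ^ 2) / ((n : ℝ) - 1))
    (measurable_pi_apply ()) (by fun_prop)

theorem mainTheorem1 {Ω : Type*} [MeasurableSpace Ω] (P : Measure Ω) [IsProbabilityMeasure P]
    (n : ℕ) (hn : 2 ≤ n) (ν : Measure ℝ) (X : Fin n → Ω → ℝ)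
    (h_law : ∀ i, HasLaw (X i) ν P) (h_indep : iIndepFun X P) :
    IndepFun (sampleMean X) (sampleVariance X) P ↔ IsNormalDistribution ν := by
  have : IsProbabilityMeasure ν :=
    (h_law ⟨0, by lia⟩).isProbabilityMeasure_iff.1 inferInstance
  constructor
  · intro h
    exact isNormalDistribution_of_indepFun_eval hn
      (indepFun_sampleMean_sampleVariance_eval h_law h_indep h)
  · rintro ⟨m, v, rfl⟩
    exact indepFun_sampleMean_sampleVariance_of_gaussian hn h_law h_indep
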